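/- An $n\times n$ sign pattern is a matrix $\mathcal P=[p_{ij}]$ with entries in $\{+,-,0\}$; its qualitative class $\mathcal Q(\mathcal P)$ is the set of all real $n\times n$ matrices $A=[a_{ij}]$ with $\operatorname{sgn}(a_{ij})=p_{ij}$ for all $i,j$. The pattern $\mathcal P$ is consistent if there is an integer $k$ with $0\le k\le n$ such that every $A\in\mathcal Q(\mathcal P)$ has exactly $k$ real eigenvalues, counted with algebraic multiplicity. It is irreducible if there is no nonempty proper subset $S\subset\{1,\dots,n\}$ with $p_{ij}=0$ for all $i\in S$, $j\notin S$, and combinatorially symmetric if $p_{ij}\ne 0\iff p_{ji}\neq 0$ for all $i,j$. The underlying signed undirected graph $G$ of a combinatorially symmetric pattern $\mathcal P$ with zero diagonal has vertex set $\{1,\dots,n\}$ and an edge $\{i,j\}$ whenever $p_{ij}\ne0$, and the sign of this edge is the product $p_{ij}p_{ji}$. A leaf of $G$ is a vertex with exactly one neighbour. Theorem. Let $\mathcal P$ be an irreducible, combinatorially symmetric $n\times n$ sign pattern all of whose diagonal entries are $0$, and let $G$ be its underlying signed undirected graph. Suppose that $u\neq v$ are two leaves of $G$ with a common neighbour $w$.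 If $\mathcal P$ is consistent, then the edges $\{u,w\}$ and $\{v,w\}$ of $G$ have the same sign. -/

import Mathlib

/-- The `n × n` sign patterns: square matrices with entries in `{+, -, 0}`. -/
abbrev SignPattern (n : ℕ) : Type := Matrix (Fin n) (Fin n) SignType

/-- The number of real eigenvalues of a real square matrix, counted with algebraic multiplicity
(the real roots of its characteristic polynomial, counted with multiplicity). -/
noncomputable def numRealEigenvalues {n : ℕ} (A : Matrix (Fin n) (Fin n) ℝ) : ℕ :=
  Multiset.card A.charpoly.roots

namespace SignPattern

variable {n : ℕ}

/-- The qualitative class of `P`: all real matrices whose entries have the signs given by `P`. -/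
def qualitativeClass (P : SignPattern n) : Set (Matrix (Fin n) (Fin n) ℝ) :=
  {A | ∀ i j, SignType.sign (A i j) = P i j}

/-- Every matrix in the qualitative class has exactly `k` real eigenvalues. -/
def IsKConsistent (P : SignPattern n) (k : ℕ) : Prop :=
  ∀ A ∈ P.qualitativeClass, numRealEigenvalues A = k

/-- `P` is `k`-consistent for some `0 ≤ k ≤ n`. -/
def IsConsistent (P : SignPattern n) : Prop :=
  ∃ k : ℕ, k ≤ n ∧ P.IsKConsistent k

/-- `P` is not permutation similar to a block triangular pattern with nonempty square diagonal
blocks: there is no nonempty proper set `S` of indices such that all entries with row in `S` and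
column outside `S` vanish. -/
def IsIrreducible (P : SignPattern n) : Prop :=
  ∀ S : Set (Fin n), S.Nonempty → S ≠ Set.univ → ∃ i ∈ S, ∃ j ∉ S, P i j ≠ 0

def IsCombinatoriallySymmetric (P : SignPattern n) : Prop :=
  ∀ i j, P i j ≠ 0 ↔ P j i ≠ 0

def HasZeroDiagonal (P : SignPattern n) : Prop :=
  ∀ i, P i i = 0

/-- The underlying undirected graph of a combinatorially symmetric pattern. Loops are left out;
there are none when the diagonal is zero. -/
def underlyingGraph (P : SignPattern n) (hP : P.IsCombinatoriallySymmetric) :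
    SimpleGraph (Fin n) where
  Adj i j := i ≠ j ∧ P i j ≠ 0
  symm := ⟨fun i j h => ⟨h.1.symm, (hP i j).1 h.2⟩⟩
  loopless := ⟨fun _ h => h.1 rfl⟩

/-- The sign of the edge `{i, j}` is the product of the two entries `P i j` and `P j i`. -/
def edgeSign (P : SignPattern n) : Sym2 (Fin n) → SignType :=
  Sym2.lift ⟨fun i j => P i j * P j i, fun _ _ => mul_comm _ _⟩

end SignPattern

/-- A leaf of a graph: a vertex with exactly one neighbour. -/
def SimpleGraph.IsLeafVertex {V : Type*} (G : SimpleGraph V) (v : V) : Prop :=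
  ∃! w, G.Adj v w

open Polynomial Filter Topology

/-! Suppose the edge `{u, w}` is positive and `{v, w}` negative. Two matrices in the qualitative
class are built whose numbers of real eigenvalues differ by two.

Let `σ` be a permutation along nonzero entries with largest support. Opening its cycle at `w`
(`exists_perm_fixing_of_symmetric`) gives `τ` fixing `w` and losing at most two points; `τ` then
also fixes the leaves `u` and `v`. With suitable positive weights on its cycles, `τ` has
characteristic polynomial `X ^ (n - |supp τ|) * h`, where `h` has only simple real roots. Adjoining
the two-cycle on `{u, w}` or on `{v, w}` with weight `s` beyond the roots of `h` replaces `h` by `(X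
^ 2 - s ^ 2) * h` or `(X ^ 2 + s ^ 2) * h`.

Both matrices have the missing entries still zero. Filling these in slightly keeps the count: the
maximality of `σ` forces the same power of `X` to divide every perturbed characteristic polynomial,
and simple real roots neither merge nor vanish (`eventually_card_roots_specialize_eq`). -/

/-! ### Permutations along a symmetric relation -/

/-- In a symmetric relation, a permutation moving points along the relation (except possibly at
`w`) can be replaced by one fixing `w` whose support is smaller by at most two: the cycle through
`w` is opened at `w` and the remaining path is cut into transpositions. -/
theorem exists_perm_fixing_of_symmetric {α : Type*} [Fintype α] [DecidableEq α]
    {E : α → α → Prop} (hE : ∀ i j, E i j → E j i) (w : α) (σ : Equiv.Perm α)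
    (hσ : ∀ i, i ≠ w → σ i ≠ i → E (σ i) i) :
    ∃ τ : Equiv.Perm α, τ w = w ∧ (∀ i, τ i ≠ i → E (τ i) i) ∧
      σ.support.card ≤ τ.support.card + (if σ w = w then 0 else 2) := by
  induction hk : (Finset.univ.filter fun i => σ (σ i) ≠ i).card using Nat.strong_induction_on
    generalizing σ with
  | _ k ih =>
  by_cases hw : σ w = w
  · exact ⟨σ, hw, fun i hi => hσ i (by rintro rfl; exact hi hw) hi, by simp⟩
  by_cases hy : σ (σ w) = w
  · refine ⟨Equiv.swap (σ w) w * σ, by simp, ?_, ?_⟩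
    · intro i hi
      have hinj := σ.injective
      by_cases h1 : i = w
      · subst h1; simp at hi
      by_cases h2 : i = σ w
      · subst h2; simp [hy] at hi
      have h3 : σ i ≠ σ w := fun h => h1 (hinj h)
      have h4 : σ i ≠ w := fun h => h2 (hinj (h.trans hy.symm))
      have h5 : (Equiv.swap (σ w) w * σ) i = σ i := by
        simp [Equiv.swap_apply_of_ne_of_ne h3 h4]
      rw [h5] at hi ⊢
      exact hσ i h1 hi
    · have hsub : σ.support ⊆ (Equiv.swap (σ w) w * σ).support ∪ {w, σ w} := by
        intro i hi
        have hinj := σ.injective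
        by_cases h1 : i = w
        · simp [h1]
        by_cases h2 : i = σ w
        · simp [h2]
        have h3 : σ i ≠ σ w := fun h => h1 (hinj h)
        have h4 : σ i ≠ w := fun h => h2 (hinj (h.trans hy.symm))
        simp only [Finset.mem_union, Equiv.Perm.mem_support, Equiv.Perm.mul_apply,
          Equiv.swap_apply_of_ne_of_ne h3 h4]
        exact Or.inl (Equiv.Perm.mem_support.1 hi)
      have h := (Finset.card_le_card hsub).trans (Finset.card_union_le _ _)
      have h2 : ({w, σ w} : Finset α).card ≤ 2 := Finset.card_le_two
      simp only [hw, if_false]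
      omega
  · obtain ⟨x, hx⟩ : ∃ x, x = σ w := ⟨_, rfl⟩
    obtain ⟨y, hyx⟩ : ∃ y, y = σ x := ⟨_, rfl⟩
    obtain ⟨z, hz⟩ : ∃ z, z = σ y := ⟨_, rfl⟩
    have hinj : ∀ a b, σ a = σ b → a = b := fun a b h => σ.injective h
    have hxw : x ≠ w := by rw [hx]; exact hw
    have hyw : y ≠ w := by rw [hyx, hx]; exact hy
    have hyx' : y ≠ x := by grind
    have hzx : z ≠ x := by grind
    have hzy : z ≠ y := by grind
    -- The path `w → x → y → z` becomes `w → z` together with the transposition of `x` and `y`. The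
    -- new step out of `w` may leave the relation, which is why `hσ` exempts `w`.
    set ρ := Equiv.swap x z * σ with hρ
    have hρw : ρ w = z := by simp [hρ, ← hx]
    have hρx : ρ x = y := by
      simp [hρ, ← hyx, Equiv.swap_apply_of_ne_of_ne hyx' hzy.symm]
    have hρy : ρ y = x := by simp [hρ, ← hz]
    have hρo : ∀ i, i ≠ w → i ≠ y → ρ i = σ i := by
      intro i h1 h2
      have h3 : σ i ≠ x := by grind
      have h4 : σ i ≠ z := by grind
      simp [hρ, Equiv.swap_apply_of_ne_of_ne h3 h4]
    have hlt : (Finset.univ.filter fun i => ρ (ρ i) ≠ i).card < k := by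
      rw [← hk]
      apply Finset.card_lt_card
      rw [Finset.ssubset_iff_of_subset]
      · exact ⟨x, by simp [← hyx, ← hz, hzx], by simp [hρx, hρy]⟩
      · intro i
        simp only [Finset.mem_filter, Finset.mem_univ, true_and]
        intro h1 h2
        clear_value ρ
        by_cases hiw : i = w
        · grind
        by_cases hiy : i = y
        · grind
        rw [hρo i hiw hiy] at h1
        by_cases hiw' : σ i = w
        · grind
        by_cases hiy' : σ i = y
        · grind
        exact h1 ((hρo _ hiw' hiy').trans h2)
    obtain ⟨τ, h1, h2, h3⟩ := ih _ hlt ρ (by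
      intro i h1 h2
      by_cases h3 : i = y
      · subst h3
        rw [hρy]
        refine hE _ _ ?_
        have := hσ x hxw (by rw [← hyx]; exact hyx')
        rwa [← hyx] at this
      · rw [hρo i h1 h3] at h2 ⊢
        exact hσ i h1 h2) rfl
    refine ⟨τ, h1, h2, ?_⟩
    rw [if_neg hw]
    -- If `z = w`, a three-cycle was opened and only `w` is lost; otherwise `ρ` still moves every
    -- point that `σ` moves.
    by_cases hzw : z = w
    · rw [if_pos (hρw.trans hzw)] at h3
      have hsub : σ.support ⊆ ρ.support ∪ {w} := by
        intro i
        simp only [Finset.mem_union, Equiv.Perm.mem_support, Finset.mem_singleton]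
        intro hi
        by_cases hiw : i = w
        · grind
        by_cases hiy : i = y
        · grind
        rw [hρo i hiw hiy]
        exact Or.inl hi
      have h := (Finset.card_le_card hsub).trans (Finset.card_union_le _ _)
      rw [Finset.card_singleton] at h
      omega
    · rw [if_neg (by rw [hρw]; exact hzw)] at h3
      have hsub : σ.support ⊆ ρ.support := by
        intro i
        simp only [Equiv.Perm.mem_support]
        intro hi
        by_cases hiw : i = w
        · grind
        by_cases hiy : i = y
        · grind
        rw [hρo i hiw hiy]
        exact hi
      have h := Finset.card_le_card hsub
      omega

/-- Agreement with `c` at one moved point propagates along its orbit: were the next point fixed by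
`σ`, it would have two preimages. Hence the Leibniz expansion for a weighted cycle has only two
nonzero terms. -/
theorem Equiv.Perm.IsCycle.eq_one_or_eq_of_forall {α : Type*} [Finite α] {c σ : Equiv.Perm α}
    (hc : c.IsCycle) (h : ∀ i, σ i = i ∨ σ i = c i) : σ = 1 ∨ σ = c := by
  by_contra! hne
  obtain ⟨i, hi⟩ : ∃ i, σ i ≠ i := by
    by_contra! hall
    exact hne.1 (Equiv.ext hall)
  have hci : c i ≠ i := by
    have := (h i).resolve_left hi
    rwa [← this]
  have hpow : ∀ k : ℕ, σ ((c ^ k) i) = c ((c ^ k) i) := by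
    intro k
    induction k with
    | zero => exact (h i).resolve_left hi
    | succ k ihk =>
      refine (h _).resolve_left fun hfix => hci ?_
      rw [pow_succ', Equiv.Perm.mul_apply, ← ihk] at hfix
      have h1 := σ.injective hfix
      rw [ihk, ← Equiv.Perm.mul_apply, ← pow_succ', pow_succ, Equiv.Perm.mul_apply] at h1
      exact (c ^ k).injective h1
  refine hne.2 (Equiv.ext fun j => ?_)
  by_cases hj : c j = j
  · rcases h j with h' | h'
    · rw [h', hj]
    · exact h'
  · obtain ⟨k, rfl⟩ := hc.exists_pow_eq hci hj
    exact hpow k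

/-! ### Characteristic polynomials of weighted permutations -/

section Charpoly

variable {ι R : Type*} [Fintype ι] [DecidableEq ι] [CommRing R]

theorem Matrix.prod_charmatrix_of_diag_eq_zero {A : Matrix ι ι R} (hA : ∀ i, A i i = 0)
    (σ : Equiv.Perm ι) :
    ∏ i, A.charmatrix (σ i) i =
      X ^ (Fintype.card ι - σ.support.card) * C (∏ i ∈ σ.support, -A (σ i) i) := by
  rw [← Finset.prod_mul_prod_compl σ.support, mul_comm, ← Finset.card_compl]
  congr 1
  · rw [← Finset.prod_const]
    refine Finset.prod_congr rfl fun i hi => ?_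
    have : σ i = i := by simpa using hi
    rw [this, Matrix.charmatrix_apply_eq, hA, map_zero, sub_zero]
  · rw [map_prod]
    refine Finset.prod_congr rfl fun i hi => ?_
    rw [Matrix.charmatrix_apply_ne _ _ _ (Equiv.Perm.mem_support.1 hi), map_neg]

/-- If the permutations along the nonzero entries of a zero-diagonal matrix move at most `m`
points, the characteristic polynomial is divisible by the complementary power of the variable. -/
theorem Matrix.X_pow_dvd_charpoly_of_card_support_le {A : Matrix ι ι R} (hA : ∀ i, A i i = 0)
    {m : ℕ} (hm : ∀ σ : Equiv.Perm ι, (∀ i, σ i ≠ i → A (σ i) i ≠ 0) → σ.support.card ≤ m) :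
    X ^ (Fintype.card ι - m) ∣ A.charpoly := by
  rw [Matrix.charpoly, Matrix.det_apply']
  refine Finset.dvd_sum fun σ _ => Dvd.dvd.mul_left ?_ _
  rw [Matrix.prod_charmatrix_of_diag_eq_zero hA]
  by_cases h : ∀ i, σ i ≠ i → A (σ i) i ≠ 0
  · exact Dvd.dvd.mul_right (pow_dvd_pow _ (Nat.sub_le_sub_left (hm σ h) _)) _
  · push Not at h
    obtain ⟨i, hi, h0⟩ := h
    rw [Finset.prod_eq_zero (Equiv.Perm.mem_support.2 hi) (by simp [h0])]
    simp

/-- When `A * B = 0`, `(X - A)(X - B) = X (X - (A + B))`; take determinants. -/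
theorem Matrix.charpoly_mul_charpoly_of_mul_eq_zero (A B : Matrix ι ι R) (h : A * B = 0) :
    A.charpoly * B.charpoly = X ^ Fintype.card ι * (A + B).charpoly := by
  have hmul : A.charmatrix * B.charmatrix = (X : R[X]) • (A + B).charmatrix := by
    have h' : C.mapMatrix A * C.mapMatrix B = 0 := by rw [← map_mul, h, map_zero]
    simp only [Matrix.charmatrix, map_add, sub_mul, mul_sub, h', Matrix.smul_eq_diagonal_mul]
    have hs : (Matrix.scalar ι (X : R[X])) = Matrix.diagonal fun _ => X := rfl
    have hcomm : C.mapMatrix A * Matrix.scalar ι (X : R[X]) =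
        Matrix.scalar ι (X : R[X]) * C.mapMatrix A :=
      ((Matrix.scalar_commute X (fun r => Commute.all _ r) _).eq).symm
    rw [hcomm, ← hs]
    noncomm_ring
  rw [Matrix.charpoly, Matrix.charpoly, ← Matrix.det_mul, hmul, Matrix.det_smul, Matrix.charpoly]

/-- The matrix with entry `t j * Q (σ j) j` at `(σ j, j)` for each `j` moved by `σ`, and zeros
elsewhere. -/
def Matrix.weightedPerm (Q : Matrix ι ι R) (σ : Equiv.Perm ι) (t : ι → R) : Matrix ι ι R :=
  Matrix.of fun i j => if σ j = i ∧ i ≠ j then t j * Q i j else 0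

theorem Matrix.charpoly_weightedPerm_of_isCycle (Q : Matrix ι ι R) {c : Equiv.Perm ι}
    (hc : c.IsCycle) (t : ι → R) :
    (Q.weightedPerm c t).charpoly = X ^ (Fintype.card ι - c.support.card) *
      (X ^ c.support.card +
        C ((Equiv.Perm.sign c : ℤ) * ∏ i ∈ c.support, -(t i * Q (c i) i))) := by
  have hdiag : ∀ i, Q.weightedPerm c t i i = 0 := by simp [Matrix.weightedPerm]
  rw [Matrix.charpoly, Matrix.det_apply', Finset.sum_eq_add_of_mem (1 : Equiv.Perm ι) c
    (Finset.mem_univ _) (Finset.mem_univ _) hc.ne_one.symm]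
  · rw [Matrix.prod_charmatrix_of_diag_eq_zero hdiag, Matrix.prod_charmatrix_of_diag_eq_zero hdiag,
      mul_add, ← pow_add, Nat.sub_add_cancel (Finset.card_le_univ _)]
    congr 1
    · simp
    · have : ∏ i ∈ c.support, -Q.weightedPerm c t (c i) i =
          ∏ i ∈ c.support, -(t i * Q (c i) i) :=
        Finset.prod_congr rfl fun i hi => by
          simp [Matrix.weightedPerm, Equiv.Perm.mem_support.1 hi]
      rw [this, map_mul, mul_left_comm]
      simp
  · rintro σ - ⟨h1, h2⟩
    rw [Matrix.prod_charmatrix_of_diag_eq_zero hdiag]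
    have : ∃ i, ¬ (σ i = i ∨ σ i = c i) := by
      by_contra! h
      exact (hc.eq_one_or_eq_of_forall fun i => h i).elim h1 h2
    obtain ⟨i, hi⟩ := this
    push Not at hi
    rw [Finset.prod_eq_zero (Equiv.Perm.mem_support.2 hi.1)]
    · simp
    · simp [Matrix.weightedPerm, hi.2.symm]

theorem Matrix.weightedPerm_congr (Q : Matrix ι ι R) (σ : Equiv.Perm ι) {t s : ι → R}
    (h : ∀ i ∈ σ.support, t i = s i) : Q.weightedPerm σ t = Q.weightedPerm σ s := by
  ext i j
  simp only [Matrix.weightedPerm, Matrix.of_apply]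
  split_ifs with hij
  · rw [h j (Equiv.Perm.mem_support.2 (by rw [hij.1]; exact hij.2))]
  · rfl

/-- The weighted matrix of `σ * τ` is the sum of those of `σ` and `τ`, whose product is zero because
no index is moved by both. -/
theorem Matrix.charpoly_weightedPerm_mul_of_disjoint (Q : Matrix ι ι R) {σ τ : Equiv.Perm ι}
    (h : σ.Disjoint τ) (t : ι → R) :
    (Q.weightedPerm σ t).charpoly * (Q.weightedPerm τ t).charpoly =
      X ^ Fintype.card ι * (Q.weightedPerm (σ * τ) t).charpoly := by
  have hadd : Q.weightedPerm (σ * τ) t = Q.weightedPerm σ t + Q.weightedPerm τ t := by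
    ext i j
    simp only [Matrix.weightedPerm, Matrix.of_apply, Matrix.add_apply]
    rcases h j with hj | hj
    · have h2 : σ (τ j) = τ j := by
        rcases h (τ j) with h' | h'
        · exact h'
        · rw [τ.injective h', hj]
      rw [← Equiv.Perm.mul_apply] at h2
      by_cases hij : i = j
      · simp [hij]
      · simp only [h2, hj]
        simp [Ne.symm hij]
    · have h2 : (σ * τ) j = σ j := by rw [Equiv.Perm.mul_apply, hj]
      by_cases hij : i = j
      · simp [hij]
      · simp only [h2, hj]
        simp [Ne.symm hij]
  rw [hadd]
  refine Matrix.charpoly_mul_charpoly_of_mul_eq_zero _ _ ?_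
  ext i j
  simp only [Matrix.mul_apply, Matrix.weightedPerm, Matrix.of_apply, Matrix.zero_apply]
  refine Finset.sum_eq_zero fun k _ => ?_
  by_cases h1 : σ k = i ∧ i ≠ k
  · by_cases h2 : τ j = k ∧ k ≠ j
    · exfalso
      rcases h k with hk | hk
      · exact h1.2 (h1.1.symm.trans hk)
      · exact h2.2 (τ.injective (hk.trans h2.1.symm))
    · rw [if_neg h2, mul_zero]
  · rw [if_neg h1, zero_mul]

end Charpoly

/-! ### Simple real roots and their stability -/

/-- All real roots are simple. -/
def Polynomial.HasSimpleRoots (p : ℝ[X]) : Prop :=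
  ∀ x, p.eval x = 0 → p.derivative.eval x ≠ 0

theorem Polynomial.HasSimpleRoots.mul {p q : ℝ[X]} (hp : p.HasSimpleRoots)
    (hq : q.HasSimpleRoots) (hpq : ∀ x, p.eval x = 0 → q.eval x ≠ 0) :
    (p * q).HasSimpleRoots := by
  intro x hx
  rw [eval_mul, mul_eq_zero] at hx
  rw [derivative_mul, eval_add, eval_mul, eval_mul]
  rcases hx with hx | hx
  · rw [hx, zero_mul, add_zero]
    exact mul_ne_zero (hp x hx) (hpq x hx)
  · rw [hx, mul_zero, zero_add]
    exact mul_ne_zero (fun h => hpq x h hx) (hq x hx)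

theorem Polynomial.HasSimpleRoots.nodup_roots {p : ℝ[X]} (hp : p.HasSimpleRoots) :
    p.roots.Nodup := by
  by_cases h0 : p = 0
  · simp [h0]
  rw [Multiset.nodup_iff_count_le_one]
  intro x
  rw [count_roots]
  by_contra! h
  have := (one_lt_rootMultiplicity_iff_isRoot h0).1 h
  exact hp x this.1 this.2

theorem Polynomial.hasSimpleRoots_X_pow_add_C {m : ℕ} (hm : m ≠ 0) {a : ℝ} (ha : a ≠ 0) :
    (X ^ m + C a : ℝ[X]).HasSimpleRoots := by
  intro x hx
  have hx0 : x ≠ 0 := by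
    rintro rfl
    simp [hm] at hx
    exact ha hx
  rw [derivative_add, derivative_C, add_zero, derivative_X_pow]
  simp [hm, hx0]

/-- The member at parameter value `ε` of a family of real polynomials whose coefficients are
polynomials in the parameter. -/
noncomputable def Polynomial.specialize (Ψ : ℝ[X][X]) (ε : ℝ) : ℝ[X] :=
  Ψ.map (evalRingHom ε)

theorem Polynomial.continuous_eval_specialize (Ψ : ℝ[X][X]) :
    Continuous fun z : ℝ × ℝ => (Ψ.specialize z.1).eval z.2 := by
  simp only [specialize, eval_map, eval₂_eq_sum_range, coe_evalRingHom]
  refine continuous_finsetSum _ fun i _ => ?_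
  exact ((Ψ.coeff i).continuous.comp continuous_fst).mul (continuous_snd.pow i)

theorem Polynomial.derivative_specialize (Ψ : ℝ[X][X]) (ε : ℝ) :
    (Ψ.specialize ε).derivative = Ψ.derivative.specialize ε := by
  rw [specialize, specialize, derivative_map]

theorem Polynomial.Monic.specialize {Ψ : ℝ[X][X]} (hΨ : Ψ.Monic) (ε : ℝ) :
    (Ψ.specialize ε).Monic :=
  hΨ.map _

theorem Polynomial.exists_forall_roots_specialize_mem_Icc {Ψ : ℝ[X][X]} (hΨ : Ψ.Monic) :
    ∃ R : ℝ, ∀ᶠ ε in 𝓝 (0 : ℝ), ∀ x, (Ψ.specialize ε).eval x = 0 → x ∈ Set.Icc (-R) R := by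
  have hcont : Continuous fun ε : ℝ =>
      ∑ i ∈ Finset.range Ψ.natDegree, ‖(Ψ.coeff i).eval ε‖₊ :=
    continuous_finsetSum _ fun i _ => (Ψ.coeff i).continuous.nnnorm
  obtain ⟨B, hB⟩ : ∃ B, B = ∑ i ∈ Finset.range Ψ.natDegree, ‖(Ψ.coeff i).eval 0‖₊ + 1 :=
    -- The sum dominates the supremum in the Cauchy bound and is continuous in the parameter; the
    -- added `1` leaves room for a neighbourhood of `0`.
    ⟨_, rfl⟩
  have hev := (hcont.continuousAt (x := 0)).eventually (p := fun y => y < B)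
    (Iio_mem_nhds (by rw [hB]; exact lt_add_one _))
  refine ⟨B + 1, hev.mono fun ε hε x hx => ?_⟩
  have hlt := IsRoot.norm_lt_cauchyBound (hΨ.specialize ε).ne_zero (a := x) hx
  have hdeg : (Ψ.specialize ε).natDegree = Ψ.natDegree := hΨ.natDegree_map _
  have hle : cauchyBound (Ψ.specialize ε) ≤ B + 1 := by
    rw [cauchyBound, (hΨ.specialize ε).leadingCoeff, hdeg]
    simp only [nnnorm_one, div_one]
    gcongr
    refine Finset.sup_le fun i hi => ?_
    have : ‖(Ψ.specialize ε).coeff i‖₊ = ‖(Ψ.coeff i).eval ε‖₊ := by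
      simp [Polynomial.specialize]
    rw [this]
    exact (Finset.single_le_sum (f := fun i => ‖(Ψ.coeff i).eval ε‖₊)
      (fun _ _ => zero_le) hi).trans hε.le
  have hnorm : ‖x‖ ≤ B + 1 := by exact_mod_cast hlt.le.trans hle
  exact abs_le.1 hnorm

theorem Polynomial.eventually_exists_root_specialize_near {Ψ : ℝ[X][X]} {ρ δ : ℝ}
    (hρ : (Ψ.specialize 0).eval ρ = 0) (hρ' : (Ψ.specialize 0).derivative.eval ρ ≠ 0)
    (hδ : 0 < δ) :
    ∀ᶠ ε in 𝓝 (0 : ℝ), ∃ x, |x - ρ| < δ ∧ (Ψ.specialize ε).eval x = 0 := by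
  obtain ⟨g, hg⟩ := dvd_iff_isRoot.2 hρ
  have hgρ : g.eval ρ ≠ 0 := by
    simpa [hg, derivative_mul] using hρ'
  have hnear : ∀ᶠ y in 𝓝 ρ, 0 < g.eval y * g.eval ρ :=
    (g.continuous.mul continuous_const).continuousAt.eventually
      (p := fun y => 0 < y) (Ioi_mem_nhds (mul_self_pos.2 hgρ))
  obtain ⟨r, hr, hball⟩ := Metric.eventually_nhds_iff.1 hnear
  obtain ⟨η, hη0, hη⟩ := exists_between (lt_min hδ hr)
  have hηδ := lt_of_lt_of_le hη (min_le_left _ _)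
  have hηr := lt_of_lt_of_le hη (min_le_right _ _)
  have h1 := hball (y := ρ - η) (by simp [abs_of_pos hη0, hηr])
  have h2 := hball (y := ρ + η) (by simp [abs_of_pos hη0, hηr])
  -- Near `ρ` the cofactor `g` keeps its sign, so the linear factor forces a sign change, which
  -- survives small `ε`.
  have hsgn : (Ψ.specialize 0).eval (ρ - η) * (Ψ.specialize 0).eval (ρ + η) < 0 := by
    have h3 : 0 < g.eval (ρ - η) * g.eval (ρ + η) := by
      have := mul_pos h1 h2
      have h4 := mul_self_pos.2 hgρ
      by_contra! h5
      nlinarith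
    rw [hg]
    simp only [eval_mul, eval_sub, eval_X, eval_C]
    nlinarith [mul_pos (mul_pos hη0 hη0) h3]
  have hc : ∀ y, Continuous fun ε => (Ψ.specialize ε).eval y := fun y =>
    (continuous_eval_specialize Ψ).comp (continuous_id.prodMk continuous_const)
  have hev := ((hc (ρ - η)).mul (hc (ρ + η))).continuousAt.eventually
    (p := fun y => y < 0) (Iio_mem_nhds hsgn)
  refine hev.mono fun ε hε => ?_
  have hivt := intermediate_value_uIcc (a := ρ - η) (b := ρ + η)
    (Ψ.specialize ε).continuous.continuousOn
  obtain ⟨x, hx, hx0⟩ := hivt (show (0 : ℝ) ∈ _ by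
    rw [Set.mem_uIcc]
    rcases mul_neg_iff.1 hε with h | h
    · exact Or.inr ⟨h.2.le, h.1.le⟩
    · exact Or.inl ⟨h.1.le, h.2.le⟩)
  rw [Set.uIcc_of_le (by linarith)] at hx
  exact ⟨x, by rw [abs_lt]; constructor <;> linarith [hx.1, hx.2], hx0⟩

/-- If the real roots of one member of a polynomial family of monic polynomials are simple, the
number of real roots is locally constant there. -/
theorem Polynomial.eventually_card_roots_specialize_eq {Ψ : ℝ[X][X]} (hΨ : Ψ.Monic)
    (h0 : (Ψ.specialize 0).HasSimpleRoots) :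
    ∀ᶠ ε in 𝓝 (0 : ℝ),
      Multiset.card (Ψ.specialize ε).roots = Multiset.card (Ψ.specialize 0).roots := by
  have hmem : ∀ ε x, x ∈ (Ψ.specialize ε).roots.toFinset ↔ (Ψ.specialize ε).eval x = 0 := by
    intro ε x
    rw [Multiset.mem_toFinset, mem_roots (hΨ.specialize ε).ne_zero, IsRoot.def]
  set S := (Ψ.specialize 0).roots.toFinset with hS
  -- a radius separating the roots on which the derivative stays away from zero
  have hrad : ∀ ρ ∈ S, ∃ r > 0, ∀ ε y, |ε| < r → |y - ρ| < r →
      (Ψ.specialize ε).derivative.eval y ≠ 0 := by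
    intro ρ hρ
    have hne : ∀ᶠ z : ℝ × ℝ in 𝓝 (0, ρ), (Ψ.derivative.specialize z.1).eval z.2 ≠ 0 :=
      (continuous_eval_specialize Ψ.derivative).continuousAt.eventually_ne
        (by rw [← derivative_specialize]; exact h0 ρ ((hmem 0 ρ).1 hρ))
    obtain ⟨r, hr, hball⟩ := Metric.eventually_nhds_iff.1 hne
    refine ⟨r, hr, fun ε y hε hy => ?_⟩
    rw [derivative_specialize]
    refine hball (y := (ε, y)) ?_
    simp [Prod.dist_eq, Real.dist_eq, hε, hy]
  have hδ : ∀ᶠ δ in 𝓝[>] (0 : ℝ),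
      (∀ ρ ∈ S, ∀ ε y, |ε| < δ → |y - ρ| < δ → (Ψ.specialize ε).derivative.eval y ≠ 0) ∧
      ∀ ρ ∈ S, ∀ ρ' ∈ S, ρ ≠ ρ' → 2 * δ < |ρ - ρ'| := by
    refine ((Finset.eventually_all S).2 fun ρ hρ => ?_).and
      ((Finset.eventually_all S).2 fun ρ hρ => (Finset.eventually_all S).2 fun ρ' hρ' => ?_)
    · obtain ⟨r, hr, h⟩ := hrad ρ hρ
      filter_upwards [Ioo_mem_nhdsGT hr] with δ hδ ε y h1 h2
      exact h ε y (h1.trans hδ.2) (h2.trans hδ.2)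
    · by_cases hne : ρ = ρ'
      · exact Eventually.of_forall fun _ h => absurd hne h
      · have : 0 < |ρ - ρ'| / 2 := by
          have := abs_pos.2 (sub_ne_zero.2 hne)
          positivity
        filter_upwards [Ioo_mem_nhdsGT this] with δ hδ _
        linarith [hδ.2]
  obtain ⟨δ, ⟨hder, hsep⟩, hδ0⟩ := (hδ.and self_mem_nhdsWithin).exists
  obtain ⟨R, hR⟩ := exists_forall_roots_specialize_mem_Icc hΨ
  -- Compactness of the interval makes the pointwise neighbourhoods uniform in `x`.
  have hclose : ∀ᶠ ε in 𝓝 (0 : ℝ), ∀ x ∈ Set.Icc (-R) R,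
      (Ψ.specialize ε).eval x = 0 → ∃ ρ ∈ S, |x - ρ| < δ := by
    refine isCompact_Icc.eventually_forall_of_forall_eventually fun x _ => ?_
    by_cases hx : (Ψ.specialize 0).eval x = 0
    · have : ∀ᶠ z : ℝ × ℝ in 𝓝 (0, x), |z.2 - x| < δ :=
        (continuous_snd.sub continuous_const).abs.continuousAt.eventually
          (p := fun y => y < δ) (Iio_mem_nhds (by simpa using hδ0))
      exact this.mono fun z hz _ => ⟨x, (hmem 0 x).2 hx, hz⟩
    · have : ∀ᶠ z : ℝ × ℝ in 𝓝 (0, x), (Ψ.specialize z.1).eval z.2 ≠ 0 :=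
        (continuous_eval_specialize Ψ).continuousAt.eventually_ne hx
      exact this.mono fun z hz h => absurd h hz
  have hexist : ∀ᶠ ε in 𝓝 (0 : ℝ), ∀ ρ ∈ S, ∃ x, |x - ρ| < δ ∧ (Ψ.specialize ε).eval x = 0 :=
    (Finset.eventually_all S).2 fun ρ hρ =>
      eventually_exists_root_specialize_near ((hmem 0 ρ).1 hρ) (h0 ρ ((hmem 0 ρ).1 hρ)) hδ0
  have hsmall : ∀ᶠ ε in 𝓝 (0 : ℝ), |ε| < δ :=
    continuous_abs.continuousAt.eventually (p := fun y => y < δ)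
      (Iio_mem_nhds (by simpa using hδ0))
  filter_upwards [hR, hclose, hexist, hsmall] with ε hR hclose hexist hsmall
  have hclose' : ∀ x ∈ (Ψ.specialize ε).roots.toFinset, ∃ ρ ∈ S, |x - ρ| < δ := fun x hx =>
    hclose x (hR x ((hmem ε x).1 hx)) ((hmem ε x).1 hx)
  have hsimple : (Ψ.specialize ε).HasSimpleRoots := by
    intro x hx
    obtain ⟨ρ, hρ, hxρ⟩ := hclose' x ((hmem ε x).2 hx)
    exact hder ρ hρ ε x hsmall hxρ
  rw [← Multiset.toFinset_card_of_nodup hsimple.nodup_roots,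
    ← Multiset.toFinset_card_of_nodup h0.nodup_roots]
  apply le_antisymm
  · choose! φ hφS hφ using hclose'
    refine Finset.card_le_card_of_injOn φ hφS ?_
    -- By Rolle, two roots near the same `ρ` would give a zero of the derivative within `δ` of `ρ`.
    have hlt : ∀ x y, x ∈ (Ψ.specialize ε).roots.toFinset → y ∈ (Ψ.specialize ε).roots.toFinset →
        φ x = φ y → ¬ x < y := by
      intro x y hx hy hxy hlt
      obtain ⟨c, hc, hc0⟩ := exists_deriv_eq_zero hlt (Ψ.specialize ε).continuous.continuousOn
        (((hmem ε x).1 hx).trans ((hmem ε y).1 hy).symm)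
      rw [Polynomial.deriv] at hc0
      have h1 := abs_lt.1 (hφ x hx)
      have h2 := abs_lt.1 (hφ y hy)
      rw [← hxy] at h2
      refine hder (φ x) (hφS x hx) ε c hsmall ?_ hc0
      rw [abs_lt]
      constructor <;> linarith [hc.1, hc.2]
    intro x hx y hy hxy
    exact le_antisymm (not_lt.1 (hlt y x hy hx hxy.symm)) (not_lt.1 (hlt x y hx hy hxy))
  · choose! φ hφ hφ0 using hexist
    refine Finset.card_le_card_of_injOn φ (fun ρ hρ => (hmem ε _).2 (hφ0 ρ hρ)) ?_
    intro ρ hρ ρ' hρ' h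
    by_contra hne
    have h1 := abs_lt.1 (hφ ρ hρ)
    have h2 := abs_lt.1 (hφ ρ' hρ')
    have h3 := hsep ρ hρ ρ' hρ' hne
    rw [h] at h1
    rcases lt_abs.1 h3 with h3 | h3 <;> linarith

/-! ### Choosing weights cycle by cycle -/

section WeightedCycles

variable {ι : Type*} [Fintype ι] [DecidableEq ι]

theorem Matrix.charpoly_weightedPerm_isCycle_mul (Q : Matrix ι ι ℝ) {c τ : Equiv.Perm ι}
    (hc : c.IsCycle) (hcτ : c.Disjoint τ) {t : ι → ℝ} {h : ℝ[X]}
    (hh : (Q.weightedPerm τ t).charpoly = X ^ (Fintype.card ι - τ.support.card) * h) (s : ℝ) :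
    (Q.weightedPerm (c * τ) fun j => if j ∈ c.support then s else t j).charpoly =
      X ^ (Fintype.card ι - (c * τ).support.card) *
        ((X ^ c.support.card +
          C ((Equiv.Perm.sign c : ℤ) * ∏ i ∈ c.support, -(s * Q (c i) i))) * h) := by
  have hmul := Q.charpoly_weightedPerm_mul_of_disjoint hcτ
    (fun j => if j ∈ c.support then s else t j)
  rw [Q.weightedPerm_congr c (s := fun _ => s) (fun i hi => if_pos hi),
    Q.weightedPerm_congr τ (s := t) (fun i hi => if_neg fun hi' =>
      Finset.disjoint_left.1 hcτ.disjoint_support hi' hi),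
    Q.charpoly_weightedPerm_of_isCycle hc, hh] at hmul
  have hcard : (c * τ).support.card ≤ Fintype.card ι := Finset.card_le_univ _
  rw [hcτ.card_support_mul] at hcard ⊢
  refine mul_left_cancel₀ (pow_ne_zero (Fintype.card ι) (X_ne_zero (R := ℝ))) ?_
  rw [← hmul, ← mul_assoc (X ^ Fintype.card ι), ← pow_add,
    show Fintype.card ι + (Fintype.card ι - (c.support.card + τ.support.card)) =
      (Fintype.card ι - c.support.card) + (Fintype.card ι - τ.support.card) by omega, pow_add]
  ring

theorem Polynomial.exists_forall_abs_root_lt {h : ℝ[X]} (hh : h ≠ 0) :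
    ∃ s : ℝ, 0 < s ∧ ∀ x, h.eval x = 0 → |x| < s := by
  refine ⟨h.cauchyBound, lt_of_lt_of_le one_pos (by exact_mod_cast one_le_cauchyBound h),
    fun x hx => ?_⟩
  have := IsRoot.norm_lt_cauchyBound hh (a := x) hx
  exact_mod_cast this

/-- Real roots of the new factor have absolute value exactly `s`, so they avoid those of `h`. -/
theorem Polynomial.HasSimpleRoots.X_pow_add_C_mul {h : ℝ[X]} (hh : h.HasSimpleRoots) {m : ℕ}
    (hm : m ≠ 0) {a s : ℝ} (hs : 0 < s) (ha : |a| = s ^ m) (hlt : ∀ x, h.eval x = 0 → |x| < s) :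
    ((X ^ m + C a) * h).HasSimpleRoots := by
  have ha0 : a ≠ 0 := by
    rw [← abs_pos, ha]
    positivity
  refine (hasSimpleRoots_X_pow_add_C hm ha0).mul hh fun x hx hx' => (hlt x hx').ne ?_
  rw [eval_add, eval_pow, eval_X, eval_C] at hx
  refine (pow_left_inj₀ (abs_nonneg x) hs.le hm).1 ?_
  rw [← ha, ← abs_pow, eq_neg_of_add_eq_zero_left hx, abs_neg]

/-- Induction on disjoint cycles: each new cycle gets a weight beyond all real roots found so far.
-/
theorem Matrix.exists_weightedPerm_charpoly_hasSimpleRoots (Q : Matrix ι ι ℝ) (τ : Equiv.Perm ι)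
    (hτ : ∀ i, τ i ≠ i → |Q (τ i) i| = 1) :
    ∃ t : ι → ℝ, (∀ j, 0 < t j) ∧ ∃ h : ℝ[X], h.HasSimpleRoots ∧
      (Q.weightedPerm τ t).charpoly = X ^ (Fintype.card ι - τ.support.card) * h := by
  have hone : ∃ t : ι → ℝ, (∀ j, 0 < t j) ∧ ∃ h : ℝ[X], h.HasSimpleRoots ∧
      (Q.weightedPerm 1 t).charpoly =
        X ^ (Fintype.card ι - (1 : Equiv.Perm ι).support.card) * h := by
    refine ⟨fun _ => 1, fun _ => one_pos, 1, fun x hx => by simp at hx, ?_⟩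
    have : Q.weightedPerm 1 (fun _ => 1) = 0 := by
      ext i j
      by_cases hij : j = i <;> simp [Matrix.weightedPerm, hij]
    simp [this]
  have hstep : ∀ c τ : Equiv.Perm ι, c.Disjoint τ → c.IsCycle →
      (∀ i, (c * τ) i ≠ i → |Q ((c * τ) i) i| = 1) →
      (∃ t : ι → ℝ, (∀ j, 0 < t j) ∧ ∃ h : ℝ[X], h.HasSimpleRoots ∧
        (Q.weightedPerm τ t).charpoly = X ^ (Fintype.card ι - τ.support.card) * h) →
      ∃ t : ι → ℝ, (∀ j, 0 < t j) ∧ ∃ h : ℝ[X], h.HasSimpleRoots ∧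
        (Q.weightedPerm (c * τ) t).charpoly =
          X ^ (Fintype.card ι - (c * τ).support.card) * h := by
    rintro c τ hcτ hc hQ ⟨t, ht, h, hh, hch⟩
    have hh0 : h ≠ 0 := by
      rintro rfl
      exact (Matrix.charpoly_monic _).ne_zero (hch.trans (mul_zero _))
    obtain ⟨s, hs, hlt⟩ := exists_forall_abs_root_lt hh0
    refine ⟨_, fun j => ?_, _, ?_, Q.charpoly_weightedPerm_isCycle_mul hc hcτ hch s⟩
    · split_ifs
      · exact hs
      · exact ht j
    · refine hh.X_pow_add_C_mul (by have := hc.two_le_card_support; omega) hs ?_ hlt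
      have hprod : ∏ i ∈ c.support, |-(s * Q (c i) i)| = s ^ c.support.card := by
        rw [← Finset.prod_const]
        refine Finset.prod_congr rfl fun i hi => ?_
        have hci := Equiv.Perm.mem_support.1 hi
        have hτi : τ i = i := (hcτ i).resolve_left hci
        have := hQ i (by rwa [Equiv.Perm.mul_apply, hτi])
        rw [Equiv.Perm.mul_apply, hτi] at this
        rw [abs_neg, abs_mul, this, mul_one, abs_of_pos hs]
      rw [abs_mul, Finset.abs_prod, hprod]
      rcases Int.units_eq_one_or (Equiv.Perm.sign c) with h1 | h1 <;> simp [h1]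
  revert hτ
  refine Equiv.Perm.cycle_induction_on (fun τ => (∀ i, τ i ≠ i → |Q (τ i) i| = 1) →
    ∃ t : ι → ℝ, (∀ j, 0 < t j) ∧ ∃ h : ℝ[X], h.HasSimpleRoots ∧
      (Q.weightedPerm τ t).charpoly = X ^ (Fintype.card ι - τ.support.card) * h) τ
    (fun _ => hone) (fun c hc hQ => ?_) (fun c τ hcτ hc _ ih hQ => ?_)
  · have := hstep c 1 (Equiv.Perm.disjoint_one_right c) hc (by rwa [mul_one]) hone
    rwa [mul_one] at this
  · refine hstep c τ hcτ hc hQ (ih fun i hi => ?_)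
    have h1 : c (τ i) = τ i := (hcτ (τ i)).resolve_right fun h => hi (τ.injective h)
    have := hQ i (by rwa [Equiv.Perm.mul_apply, h1])
    rwa [Equiv.Perm.mul_apply, h1] at this

theorem Polynomial.card_roots_X_sq_sub_C_mul {h : ℝ[X]} (hh : h ≠ 0) (s : ℝ) :
    Multiset.card ((X ^ 2 + C (-s ^ 2)) * h).roots = 2 + Multiset.card h.roots := by
  have : (X ^ 2 + C (-s ^ 2) : ℝ[X]) = (X - C s) * (X - C (-s)) := by
    simp only [map_neg, map_pow]
    ring
  rw [this, mul_assoc, roots_mul (mul_ne_zero (X_sub_C_ne_zero _)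
    (mul_ne_zero (X_sub_C_ne_zero _) hh)), roots_mul (mul_ne_zero (X_sub_C_ne_zero _) hh),
    roots_X_sub_C, roots_X_sub_C, Multiset.card_add, Multiset.card_add]
  simp
  ring

theorem Polynomial.card_roots_X_sq_add_C_mul {h : ℝ[X]} (hh : h ≠ 0) {s : ℝ} (hs : 0 < s) :
    Multiset.card ((X ^ 2 + C (s ^ 2)) * h).roots = Multiset.card h.roots := by
  have hne : (X ^ 2 + C (s ^ 2) : ℝ[X]) ≠ 0 := (monic_X_pow_add_C _ two_ne_zero).ne_zero
  have h0 : (X ^ 2 + C (s ^ 2) : ℝ[X]).roots = 0 := by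
    refine Multiset.eq_zero_of_forall_notMem fun x hx => ?_
    rw [mem_roots hne, IsRoot.def] at hx
    simp only [eval_add, eval_pow, eval_X, eval_C] at hx
    nlinarith [sq_nonneg x, pow_pos hs 2]
  rw [roots_mul (mul_ne_zero hne hh), h0, zero_add]

end WeightedCycles

/-! ### Perturbation into the qualitative class and the contradiction -/

namespace SignPattern

variable {n : ℕ}

/-- The representative of the qualitative class with entries in `{1, -1, 0}`. -/
def toReal (P : SignPattern n) : Matrix (Fin n) (Fin n) ℝ :=
  Matrix.of fun i j => (P i j : ℝ)

theorem abs_toReal_eq_one {P : SignPattern n} {i j : Fin n} (h : P i j ≠ 0) :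
    |P.toReal i j| = 1 := by
  simp only [toReal, Matrix.of_apply]
  cases hP : P i j <;> simp_all

theorem sign_mul_toReal (P : SignPattern n) (i j : Fin n) {t : ℝ} (ht : 0 < t) :
    SignType.sign (t * P.toReal i j) = P i j := by
  simp only [toReal, Matrix.of_apply, sign_mul, sign_pos ht, one_mul]
  cases hP : P i j <;> simp

/-- A matrix subordinate to `P` whose characteristic polynomial has the generic order of vanishing
at zero and otherwise only simple real roots can be perturbed into the qualitative class without
changing the number of real eigenvalues. -/
theorem exists_mem_qualitativeClass_numRealEigenvalues_eq {P : SignPattern n}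
    (hdiag : P.HasZeroDiagonal) {m : ℕ}
    (hm : ∀ σ : Equiv.Perm (Fin n), (∀ i, σ i ≠ i → P (σ i) i ≠ 0) → σ.support.card ≤ m)
    {A : Matrix (Fin n) (Fin n) ℝ} (hA : ∀ i j, A i j ≠ 0 → SignType.sign (A i j) = P i j)
    {f : ℝ[X]} (hf : f.HasSimpleRoots) (hAf : A.charpoly = X ^ (n - m) * f) :
    ∃ B ∈ P.qualitativeClass, numRealEigenvalues B = n - m + Multiset.card f.roots := by
  have hzero : ∀ i j, P i j = 0 → A i j = 0 ∧ P.toReal i j = 0 := by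
    intro i j hij
    refine ⟨?_, by simp [toReal, hij]⟩
    by_contra h
    exact h (sign_eq_zero_iff.1 ((hA i j h).trans hij))
  set F : Matrix (Fin n) (Fin n) ℝ[X] := Matrix.of fun i j => C (A i j) + X * C (P.toReal i j)
    with hF
  have hFzero : ∀ i j, P i j = 0 → F i j = 0 := by
    intro i j hij
    simp [hF, (hzero i j hij).1, (hzero i j hij).2]
  -- Dividing over `ℝ[X]` removes the zero eigenvalues for all `ε` at once and leaves a polynomial
  -- family `Ψ`.
  obtain ⟨Ψ, hΨ⟩ : X ^ (n - m) ∣ F.charpoly := by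
    have := Matrix.X_pow_dvd_charpoly_of_card_support_le (A := F) (m := m)
      (fun i => hFzero i i (hdiag i)) fun σ hσ =>
        hm σ fun i hi h0 => hσ i hi (hFzero _ _ h0)
    rwa [Fintype.card_fin] at this
  have hmonic : Ψ.Monic :=
    (monic_X_pow (n - m)).of_mul_monic_left (hΨ ▸ Matrix.charpoly_monic F)
  have hspec : ∀ ε : ℝ, (A + ε • P.toReal).charpoly = X ^ (n - m) * Ψ.specialize ε := by
    intro ε
    have hmap : A + ε • P.toReal = F.map (evalRingHom ε) := by
      ext i j
      simp [hF, mul_comm ε]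
    rw [hmap, Matrix.charpoly_map, hΨ, Polynomial.map_mul, Polynomial.map_pow, map_X]
    rfl
  have hΨ0 : Ψ.specialize 0 = f := by
    have := hspec 0
    rw [zero_smul, add_zero, hAf] at this
    exact (mul_left_cancel₀ (pow_ne_zero _ X_ne_zero) this).symm
  have hev := eventually_card_roots_specialize_eq hmonic (hΨ0 ▸ hf)
  obtain ⟨ε, hε, hε0⟩ :=
    ((hev.filter_mono (nhdsWithin_le_nhds (s := Set.Ioi 0))).and self_mem_nhdsWithin).exists
  have hε0 : 0 < ε := hε0
  refine ⟨A + ε • P.toReal, fun i j => ?_, ?_⟩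
  · have h1 := P.sign_mul_toReal i j hε0
    simp only [Matrix.add_apply, Matrix.smul_apply, smul_eq_mul]
    by_cases h0 : A i j = 0
    · rw [h0, zero_add, h1]
    · have h2 := hA i j h0
      rcases lt_trichotomy (A i j) 0 with hlt | heq | hgt
      · rw [sign_neg hlt] at h2
        rw [← h2] at h1 ⊢
        exact sign_neg (add_neg hlt (sign_eq_neg_one_iff.1 h1))
      · exact absurd heq h0
      · rw [sign_pos hgt] at h2
        rw [← h2] at h1 ⊢
        exact sign_pos (add_pos hgt (sign_eq_one_iff.1 h1))
  · rw [numRealEigenvalues, hspec, roots_mul (mul_ne_zero (pow_ne_zero _ X_ne_zero)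
      (hmonic.specialize ε).ne_zero), Multiset.card_add, hε, hΨ0]
    simp

/-- The number of real eigenvalues attained near a weighted permutation with `u` and `w` on a
common two-cycle. -/
theorem exists_numRealEigenvalues_eq_of_swap {P : SignPattern n} (hdiag : P.HasZeroDiagonal)
    {u w : Fin n} (huw : u ≠ w) {τ : Equiv.Perm (Fin n)} (hu : τ u = u) (hw : τ w = w)
    (hm : ∀ σ : Equiv.Perm (Fin n), (∀ i, σ i ≠ i → P (σ i) i ≠ 0) →
      σ.support.card ≤ τ.support.card + 2)
    {t : Fin n → ℝ} (ht : ∀ j, 0 < t j) {h : ℝ[X]} (hh : h.HasSimpleRoots)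
    (hch : (P.toReal.weightedPerm τ t).charpoly = X ^ (n - τ.support.card) * h)
    {s : ℝ} (hs : 0 < s) (hlt : ∀ x, h.eval x = 0 → |x| < s)
    {e : ℝ} (he : P.toReal u w * P.toReal w u = e) (he1 : |e| = 1) :
    ∃ B ∈ P.qualitativeClass, numRealEigenvalues B =
      n - (τ.support.card + 2) + Multiset.card ((X ^ 2 + C (-(e * s ^ 2))) * h).roots := by
  have hc : (Equiv.swap u w).IsCycle := Equiv.Perm.isCycle_swap huw
  have hsupp : (Equiv.swap u w).support = {u, w} := Equiv.Perm.support_swap huw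
  have hcτ : (Equiv.swap u w).Disjoint τ := by
    intro i
    by_cases h1 : i = u
    · exact Or.inr (h1 ▸ hu)
    by_cases h2 : i = w
    · exact Or.inr (h2 ▸ hw)
    exact Or.inl (Equiv.swap_apply_of_ne_of_ne h1 h2)
  have hchar := P.toReal.charpoly_weightedPerm_isCycle_mul hc hcτ
    (by rwa [Fintype.card_fin]) s
  have ha : ((Equiv.Perm.sign (Equiv.swap u w) : ℤ) : ℝ) *
      ∏ i ∈ (Equiv.swap u w).support, -(s * P.toReal (Equiv.swap u w i) i) = -(e * s ^ 2) := by
    rw [hsupp, Finset.prod_pair huw, Equiv.Perm.sign_swap huw, Equiv.swap_apply_left,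
      Equiv.swap_apply_right, ← he]
    push_cast
    ring
  rw [ha, hcτ.card_support_mul, Equiv.Perm.card_support_swap huw, Fintype.card_fin,
    add_comm 2] at hchar
  refine exists_mem_qualitativeClass_numRealEigenvalues_eq hdiag hm (fun i j hij => ?_)
    (hh.X_pow_add_C_mul two_ne_zero hs ?_ hlt) hchar
  · simp only [Matrix.weightedPerm, Matrix.of_apply] at hij ⊢
    by_cases h1 : (Equiv.swap u w * τ) j = i ∧ i ≠ j
    · rw [if_pos h1]
      refine P.sign_mul_toReal i j ?_
      split_ifs
      · exact hs
      · exact ht j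
    · rw [if_neg h1] at hij
      exact absurd rfl hij
  · rw [abs_neg, abs_mul, he1, one_mul, abs_of_pos (by positivity)]

theorem not_isConsistent_of_edgeSign {P : SignPattern n}
    (hsymm : P.IsCombinatoriallySymmetric) (hdiag : P.HasZeroDiagonal) {u v w : Fin n}
    (hu : (P.underlyingGraph hsymm).IsLeafVertex u)
    (hv : (P.underlyingGraph hsymm).IsLeafVertex v)
    (huw : (P.underlyingGraph hsymm).Adj u w) (hvw : (P.underlyingGraph hsymm).Adj v w)
    (hpos : P u w * P w u = 1) (hneg : P v w * P w v = -1) : ¬ P.IsConsistent := by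
  rintro ⟨k, -, hk⟩
  obtain ⟨σ, hσ, hmax⟩ := Finset.exists_max_image
    (Finset.univ.filter fun σ : Equiv.Perm (Fin n) => ∀ i, σ i ≠ i → P (σ i) i ≠ 0)
    (fun σ => σ.support.card) ⟨1, by simp⟩
  obtain ⟨τ, hτw, hτ, hle⟩ := exists_perm_fixing_of_symmetric (E := fun i j => P i j ≠ 0)
    (fun i j => (hsymm i j).1) w σ fun i _ => (Finset.mem_filter.1 hσ).2 i
  have hm : ∀ ρ : Equiv.Perm (Fin n), (∀ i, ρ i ≠ i → P (ρ i) i ≠ 0) →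
      ρ.support.card ≤ τ.support.card + 2 := by
    intro ρ hρ
    have h1 := hmax ρ (Finset.mem_filter.2 ⟨Finset.mem_univ _, hρ⟩)
    split_ifs at hle <;> omega
  -- A leaf moved by `τ` could only go to `w`, which is already its own image.
  have hfix : ∀ x, (P.underlyingGraph hsymm).IsLeafVertex x →
      (P.underlyingGraph hsymm).Adj x w → τ x = x := by
    intro x hx hxw
    by_contra h
    have h1 : τ x = w := hx.unique (y₁ := τ x) ⟨Ne.symm h, (hsymm _ _).1 (hτ x h)⟩ hxw
    exact hxw.1 (τ.injective (h1.trans hτw.symm))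
  obtain ⟨t, ht, h, hh, hch⟩ := P.toReal.exists_weightedPerm_charpoly_hasSimpleRoots τ
    fun i hi => abs_toReal_eq_one (hτ i hi)
  have hh0 : h ≠ 0 := by
    rintro rfl
    exact (Matrix.charpoly_monic _).ne_zero (hch.trans (mul_zero _))
  rw [Fintype.card_fin] at hch
  obtain ⟨s, hs, hlt⟩ := exists_forall_abs_root_lt hh0
  obtain ⟨A, hA, hAn⟩ := exists_numRealEigenvalues_eq_of_swap hdiag huw.1 (hfix u hu huw) hτw hm
    ht hh hch hs hlt (e := 1) (by
      simp only [toReal, Matrix.of_apply]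
      rw [← SignType.coe_mul, hpos, SignType.coe_one]) (by simp)
  obtain ⟨B, hB, hBn⟩ := exists_numRealEigenvalues_eq_of_swap hdiag hvw.1 (hfix v hv hvw) hτw hm
    ht hh hch hs hlt (e := -1) (by
      simp only [toReal, Matrix.of_apply]
      rw [← SignType.coe_mul, hneg, SignType.coe_neg_one]) (by simp)
  rw [hk A hA, one_mul, card_roots_X_sq_sub_C_mul hh0] at hAn
  rw [hk B hB, neg_one_mul, neg_neg, card_roots_X_sq_add_C_mul hh0 hs] at hBn
  omega

end SignPattern

theorem theorem3p8 {n : ℕ} (P : SignPattern n)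
    (hirr : P.IsIrreducible) (hsymm : P.IsCombinatoriallySymmetric) (hdiag : P.HasZeroDiagonal)
    (u v w : Fin n) (huv : u ≠ v)
    (hu : (P.underlyingGraph hsymm).IsLeafVertex u)
    (hv : (P.underlyingGraph hsymm).IsLeafVertex v)
    (huw : (P.underlyingGraph hsymm).Adj u w)
    (hvw : (P.underlyingGraph hsymm).Adj v w)
    (hcons : P.IsConsistent) :
    P.edgeSign s(u, w) = P.edgeSign s(v, w) := by
  have hsign : ∀ x, (P.underlyingGraph hsymm).Adj x w →
      P x w * P w x = 1 ∨ P x w * P w x = -1 := by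
    intro x hx
    have h1 : P x w * P w x ≠ 0 := mul_ne_zero hx.2 ((hsymm x w).1 hx.2)
    revert h1
    generalize P x w * P w x = a
    revert a
    decide
  change P u w * P w u = P v w * P w v
  rcases hsign u huw with h1 | h1 <;> rcases hsign v hvw with h2 | h2
  · rw [h1, h2]
  · exact absurd hcons (SignPattern.not_isConsistent_of_edgeSign hsymm hdiag hu hv huw hvw h1 h2)
  · exact absurd hcons (SignPattern.not_isConsistent_of_edgeSign hsymm hdiag hv hu hvw huw h2 h1)
  · rw [h1, h2]
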